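/- Let $X=\{0,1\}^{\mathbb N}$ be the Cantor space with the standard product probability measure $\mu$ (independent fair bits), and let $F_\infty=\langle\gamma_1,\gamma_2,\dots\rangle$ be the free group on countably many generators. A Borel action of $F_\infty$ on $X$ is an action by Borel bijections. For $r\ge 1$ let $W_r\subset F_\infty$ be the set of reduced words of length at most $r$ in the letters $\gamma_1^{\pm1},\dots,\gamma_r^{\pm1}$. Let $\theta$ be an action of $F_\infty$ on a set $Z$ each of whose points is labeled by an element of $X$. The $r$-labeled $r$-neighborhood $B_r^r(z)$ of $z\in Z$ is the rooted, edge-colored, directed multigraph with root $z$ and vertex set $\theta(W_r,z)$, with an edge of color $\gamma_i^{\pm1}$ ($1\le i\le r$) from $u$ to $v$ whenever $\theta(\gamma_i^{\pm1},u)=v$, each vertex carrying the first $r$ digits of its label. Let $U^{r,r}$ be the (finite) set of isomorphism types of $r$-labeled $r$-neighborhoods, that is, of rooted directed multigraphs with edges colored by $\gamma_1^{\pm1},\dots,\gamma_r^{\pm1}$ and vertices labeled by $\{0,1\}^r$ such that the out-edges of each vertex have different colors, the reverse of an edge is an edge of the inverse color, and every vertex is joined to the root by a path of length at most $r$; isomorphisms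 preserve root, colored edges and labels. For $\alpha\in U^{r,r}$ put $T(\theta,\alpha)=\{z\in Z: B_r^r(z)\cong\alpha\}$. For a Borel action on $X$, each point being labeled by itself, let $p_\alpha(\theta)=\mu(T(\theta,\alpha))$; for an action on a nonempty finite labeled set $Y$ let $p_\alpha(\theta)=|T(\theta,\alpha)|/|Y|$. A Borel action $\theta$ of $F_\infty$ on $X$ is called sofic if there is a sequence of actions $\theta_n$ of $F_\infty$ on nonempty finite $X$-labeled sets $Y_n$ such that $\lim_{n\to\infty}p_\alpha(\theta_n)=p_\alpha(\theta)$ for all $r\ge1$ and $\alpha\in U^{r,r}$. Borel actions $\theta_1,\theta_2$ on $X$ are measured orbit equivalent if there is an isomorphism modulo null sets $\varphi:(X,\mu)\to(X,\mu)$ of probability spaces (a Borel measure-preserving map with a Borel measure-preserving almost everywhere inverse) such that for $\mu$-almost every $x$ the map $\varphi$ takes the $\theta_1$-orbit of $x$ onto the $\theta_2$-orbit of $\varphi(x)$. An equivalence relation $E$ on $X$ is called sofic if its classes are the orbits of some sofic Borel action of $F_\infty$. **Theorem.** (1) Let $\theta_1$ and $\theta_2$ be Borel actions of $F_\infty$ on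 $X$. If $\theta_1$ is sofic and $\theta_2$ is measured orbit equivalent to $\theta_1$, then $\theta_2$ is sofic. (2) Consequently soficity is a property of the equivalence relation and not of the generating action: if $E$ is a sofic equivalence relation on $X$, then every Borel action of $F_\infty$ on $X$ whose orbits are the classes of $E$ is sofic. -/

import Mathlib

open MeasureTheory Filter Topology

namespace SoficRel

/-- The Cantor space of infinite binary sequences, with its product (= Borel) σ-algebra. -/
abbrev Cantor : Type := ℕ → Bool

/-- The standard product probability measure on the Cantor space: the coordinates are
independent fair bits. -/
noncomputable def cantorMeasure : Measure Cantor :=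
  Measure.infinitePi fun _ : ℕ => ProbabilityTheory.uniformOn (Set.univ : Set Bool)

/-- The free group on countably many generators. -/
abbrev FInf : Type := FreeGroup ℕ

/-- An action of the free group on `Z`, as a homomorphism into the permutations of `Z`. -/
abbrev Action (Z : Type) : Type := FInf →* Equiv.Perm Z

/-- A Borel action on the Cantor space: every group element acts by a Borel map. -/
def IsBorelAction (θ : Action Cantor) : Prop :=
  ∀ g : FInf, Measurable fun x => θ g x

/-- The orbit of a point. -/
def orbit {Z : Type} (θ : Action Z) (z : Z) : Set Z := Set.range fun g => θ g z

/-- The group elements whose reduced words have length at most `r` and use only the first `r`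
generators (numbered `0, …, r - 1`) and their inverses. -/
def wordBall (r : ℕ) : Set FInf :=
  {g | g.toWord.length ≤ r ∧ ∀ c ∈ g.toWord, c.1 < r}

/-- The colours of the edges of an `r`-neighbourhood: `(i, true)` is the `i`-th generator,
`(i, false)` is its inverse. -/
abbrev Color (r : ℕ) : Type := Fin r × Bool

/-- The group element named by a colour. -/
def Color.elt {r : ℕ} (c : Color r) : FInf := FreeGroup.mk [((c.1 : ℕ), c.2)]

/-- An `r`-labeled `r`-neighbourhood: a rooted directed multigraph with edges coloured by the first
`r` generators and their inverses (`edge c u v` says that there is an edge of colour `c` from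
`u` to `v`) and with vertices labeled by binary words of length `r`. -/
structure Nbhd (r : ℕ) where
  /-- the vertices -/
  V : Type
  /-- the root -/
  root : V
  /-- the coloured edges -/
  edge : Color r → V → V → Prop
  /-- the labels of the vertices -/
  label : V → Fin r → Bool
  /-- the out-edges of a vertex have different colours -/
  edge_unique : ∀ c u v w, edge c u v → edge c u w → v = w
  /-- the reverse of an edge carries the inverse colour -/
  edge_symm : ∀ i b u v, edge (i, b) u v → edge (i, !b) v u
  /-- every vertex is joined to the root by a path of length at most `r` -/
  connected : ∀ v, ∃ n ≤ r, ∃ p : ℕ → V, p 0 = root ∧ p n = v ∧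
    ∀ k < n, ∃ c, edge c (p k) (p (k + 1))

/-- Two labeled neighbourhoods have the same isomorphism type: there is a bijection of the
vertices that preserves the root, the coloured edges and the labels. -/
def Nbhd.Iso {r : ℕ} (α β : Nbhd r) : Prop :=
  ∃ e : α.V ≃ β.V, e α.root = β.root ∧
    (∀ c u v, α.edge c u v ↔ β.edge c (e u) (e v)) ∧
    ∀ u, α.label u = β.label (e u)

theorem one_mem_wordBall (r : ℕ) : (1 : FInf) ∈ wordBall r := by
  simp [wordBall]

theorem toWord_mk_drop (g : FInf) (m : ℕ) :
    (FreeGroup.mk (g.toWord.drop m)).toWord = g.toWord.drop m := by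
  rw [FreeGroup.toWord_mk]
  exact (FreeGroup.isReduced_toWord.infix (List.drop_suffix m g.toWord).isInfix).reduce_eq

theorem mk_drop_mem_wordBall {r : ℕ} {g : FInf} (hg : g ∈ wordBall r) (m : ℕ) :
    FreeGroup.mk (g.toWord.drop m) ∈ wordBall r := by
  refine ⟨?_, fun c hc => ?_⟩
  · rw [toWord_mk_drop, List.length_drop]
    exact (Nat.sub_le _ _).trans hg.1
  · rw [toWord_mk_drop] at hc
    exact hg.2 c (List.mem_of_mem_drop hc)

/-- The `r`-labeled `r`-neighbourhood of a point `z` for an action on a set `Z` whose points are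
labeled by points of the Cantor space: its vertices are the points `θ g z` with `g` in the word
ball of radius `r`, it has all the edges of the first `r` generators and their inverses
between these, and its vertices keep the first `r` digits of their labels. -/
def nbhd {Z : Type} (θ : Action Z) (lab : Z → Cantor) (r : ℕ) (z : Z) : Nbhd r where
  V := {y : Z // ∃ g ∈ wordBall r, θ g z = y}
  root := ⟨z, 1, one_mem_wordBall r, by simp⟩
  edge c u v := θ c.elt u.1 = v.1
  label u i := lab u.1 i
  edge_unique c u v w h h' := Subtype.ext (h.symm.trans h')
  edge_symm i b u v h := by
    have e : (Color.elt ((i, !b) : Color r)) = (Color.elt ((i, b) : Color r))⁻¹ := by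
      simp [Color.elt, FreeGroup.invRev]
    rw [e, map_inv, ← h, ← Equiv.Perm.mul_apply, inv_mul_cancel, Equiv.Perm.one_apply]
  connected := by
    rintro ⟨v, g, hg, rfl⟩
    refine ⟨g.toWord.length, hg.1, fun k =>
      ⟨θ (FreeGroup.mk (g.toWord.drop (g.toWord.length - k))) z, _,
        mk_drop_mem_wordBall hg _, rfl⟩, ?_, ?_, fun k hk => ?_⟩
    · apply Subtype.ext
      simp [← FreeGroup.one_eq_mk]
    · apply Subtype.ext
      simp [FreeGroup.mk_toWord]
    · have hm : g.toWord.length - (k + 1) < g.toWord.length := by omega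
      have hd := List.drop_eq_getElem_cons hm
      have hk' : g.toWord.length - (k + 1) + 1 = g.toWord.length - k := by omega
      rw [hk'] at hd
      refine ⟨(⟨(g.toWord[g.toWord.length - (k + 1)]).1, hg.2 _ (List.getElem_mem hm)⟩,
        (g.toWord[g.toWord.length - (k + 1)]).2), ?_⟩
      change θ (Color.elt _) (θ (FreeGroup.mk _) z) = θ (FreeGroup.mk _) z
      rw [hd, ← Equiv.Perm.mul_apply, ← map_mul, Color.elt, FreeGroup.mul_mk]
      rfl

/-- The set of points whose labeled neighbourhood has the isomorphism type of `α`. -/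
def typeSet {Z : Type} (θ : Action Z) (lab : Z → Cantor) {r : ℕ} (α : Nbhd r) : Set Z :=
  {z | (nbhd θ lab r z).Iso α}

/-- The probability of the type `α` for an action on the Cantor space, each point of which is
labeled by itself. -/
noncomputable def cantorProb (θ : Action Cantor) {r : ℕ} (α : Nbhd r) : ℝ :=
  cantorMeasure.real (typeSet θ id α)

/-- An action of the free group on a nonempty finite set whose points are labeled by points of
the Cantor space. -/
structure FiniteAction where
  /-- the finite set -/
  Y : Type
  /-- it is finite -/
  finite : Finite Y
  /-- it is nonempty -/
  nonempty : Nonempty Y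
  /-- the action -/
  act : Action Y
  /-- the labels -/
  label : Y → Cantor

/-- The proportion of the points of type `α` in a finite labeled action. -/
noncomputable def FiniteAction.prob (F : FiniteAction) {r : ℕ} (α : Nbhd r) : ℝ :=
  ((typeSet F.act F.label α).ncard : ℝ) / (Nat.card F.Y : ℝ)

/-- An action on the Cantor space is sofic if its local statistics are the limits of the local
statistics of a sequence of finite labeled actions. -/
def IsSofic (θ : Action Cantor) : Prop :=
  ∃ F : ℕ → FiniteAction, ∀ r : ℕ, 1 ≤ r → ∀ α : Nbhd r,
    Tendsto (fun n => (F n).prob α) atTop (𝓝 (cantorProb θ α))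

/-- Measured orbit equivalence: an isomorphism mod null sets `φ` of the probability space (with
inverse `ψ`) that takes the orbit of almost every point onto the orbit of its image. -/
def OrbitEquivalent (θ₁ θ₂ : Action Cantor) : Prop :=
  ∃ φ ψ : Cantor → Cantor,
    MeasurePreserving φ cantorMeasure cantorMeasure ∧
    MeasurePreserving ψ cantorMeasure cantorMeasure ∧
    (∀ᵐ x ∂cantorMeasure, ψ (φ x) = x) ∧
    (∀ᵐ x ∂cantorMeasure, φ (ψ x) = x) ∧
    ∀ᵐ x ∂cantorMeasure, φ '' orbit θ₁ x = orbit θ₂ (φ x)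

/-- The action `θ` defines the equivalence relation `E`: the classes of `E` are its orbits. -/
def Defines (θ : Action Cantor) (E : Setoid Cantor) : Prop :=
  ∀ x y, E x y ↔ y ∈ orbit θ x

/-- An equivalence relation on the Cantor space is sofic if it is defined by a sofic Borel action
of the free group. -/
def IsSoficRelation (E : Setoid Cantor) : Prop :=
  ∃ θ : Action Cantor, IsBorelAction θ ∧ Defines θ E ∧ IsSofic θ

end SoficRel

/-!
Points of a labeled action are described by their codes, in the compact space
`FInf × Option ℕ → Bool`: the digits of the labels of all translates of the point, and its
stabilizer. An `r`-neighbourhood and the restriction of the code to a certain finite set of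
coordinates determine each other (`nbhd_iso_iff`), so an action `θ` is sofic when the laws of the
codes in finite actions converge, on every clopen set, to the law of the code under `θ`
(`tendsto_prob_iff`). As finite actions are by permutations, a sofic action preserves the measure
(`IsSofic.measurePreserving`).

Let `φ` be an orbit equivalence from the sofic action `θ₁` to `θ₂`. The letter `c` of `θ₂` moves
`φ x` to `φ (θ₁ (f c x) x)` for a measurable rule `f c : Cantor → FInf`. The rules `f c` and the
digits of `φ` are almost everywhere the eventual values of locally constant functions
(`exists_isLocallyConstant_ae_eventually`), and because `θ₁` preserves null sets this holds
simultaneously at all points of almost every orbit. A locally constant rule can be followed in every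
labeled action, and the end of a walk that follows such rules depends continuously on the code of
its start. So the approximate rules and labels give a continuous map `recode` of the space of
codes, which at the code of almost every `x` under `θ₁` converges, as the rules improve, to the
code of `φ x` under `θ₂`; since `φ` preserves the measure, its law is the law of `θ₂`.

In a finite model of `θ₁` the approximate rules need not act by permutations, but they are
injective where the rule for the inverse letter leads back. This is a clopen condition on the code,
so its failure is as rare in the model as in the Cantor space. Extending the injective part to a
permutation gives a finite action whose codes are mostly those computed by `recode`
(`FiniteAction.exists_recoded`). If the rules are fixed first and the model of `θ₁` afterwards, this
finite action is as good a model of `θ₂` as desired.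
-/

namespace SoficRel

/-! ### Neighbourhoods and codes -/

/-- The coordinates of a code: `(g, some i)` asks for the `i`-th digit of the label of the point
moved by `g`, and `(g, none)` asks whether `g` fixes the point. -/
abbrev Coord : Type := FInf × Option ℕ

/-- The compact space in which the codes of points of labeled actions live. -/
abbrev Code : Type := Coord → Bool

open Classical in
/-- The code of a point `z` of a labeled action: all digits of the labels of all its translates,
and its stabilizer. The whole labeled Schreier graph of the orbit can be read off from it. -/
noncomputable def code {Z : Type} (θ : Action Z) (lab : Z → Cantor) (z : Z) : Code := fun p =>
  p.2.elim (decide (θ p.1 z = z)) fun i => lab (θ p.1 z) i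

section Code

variable {Z Z' : Type} (θ : Action Z) (lab : Z → Cantor) (θ' : Action Z') (lab' : Z' → Cantor)

@[simp] theorem code_some (z : Z) (g : FInf) (i : ℕ) :
    code θ lab z (g, some i) = lab (θ g z) i := rfl

@[simp] theorem code_none (z : Z) (g : FInf) : code θ lab z (g, none) = true ↔ θ g z = z := by
  simp [code]

theorem code_none_inv_mul (z : Z) (g h : FInf) :
    code θ lab z (h⁻¹ * g, none) = true ↔ θ g z = θ h z := by
  rw [code_none, map_mul, map_inv, Equiv.Perm.mul_apply, Equiv.Perm.inv_eq_iff_eq, eq_comm]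

theorem code_none_eq_iff (z : Z) (z' : Z') (g h : FInf) :
    code θ lab z (h⁻¹ * g, none) = code θ' lab' z' (h⁻¹ * g, none) ↔
      (θ g z = θ h z ↔ θ' g z' = θ' h z') := by
  rw [Bool.eq_iff_iff, code_none_inv_mul, code_none_inv_mul]

end Code

/-- The coordinates of a code that an `r`-labeled `r`-neighbourhood determines. -/
def coords (r : ℕ) : Set Coord :=
  (fun q : FInf × ℕ => (q.1, some q.2)) '' (wordBall r ×ˢ Set.Iio r) ∪
    ((fun q : FInf × FInf => (q.2⁻¹ * q.1, none)) '' (wordBall r ×ˢ wordBall r) ∪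
      (fun q : (Color r × FInf) × FInf => (q.2⁻¹ * (q.1.1.elt * q.1.2), none)) ''
        ((Set.univ ×ˢ wordBall r) ×ˢ wordBall r))

theorem mk_mem_wordBall {r : ℕ} {l : List (ℕ × Bool)} (hl : l.length ≤ r)
    (hc : ∀ c ∈ l, c.1 < r) : (FreeGroup.mk l : FInf) ∈ wordBall r := by
  have h : (FreeGroup.mk l).toWord.Sublist l := by
    rw [FreeGroup.toWord_mk]
    exact FreeGroup.Red.sublist FreeGroup.reduce.red
  exact ⟨h.length_le.trans hl, fun c hc' => hc c (h.subset hc')⟩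

theorem finite_wordBall (r : ℕ) : (wordBall r).Finite := by
  have h : {l : List (Fin r × Bool) | l.length ≤ r}.Finite := List.finite_length_le _ r
  refine (h.image fun l => (FreeGroup.mk (l.map fun c => ((c.1 : ℕ), c.2)) : FInf)).subset ?_
  intro g hg
  refine ⟨g.toWord.pmap (fun c hc => (⟨c.1, hc⟩, c.2)) hg.2, ?_, ?_⟩
  · simpa using hg.1
  · simp [List.map_pmap, List.pmap_eq_map, FreeGroup.mk_toWord]

theorem finite_coords (r : ℕ) : (coords r).Finite :=
  (((finite_wordBall r).prod (Set.finite_Iio r)).image _).union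
    ((((finite_wordBall r).prod (finite_wordBall r)).image _).union
      (((Set.finite_univ.prod (finite_wordBall r)).prod (finite_wordBall r)).image _))

theorem mem_wordBall_of_le {r s : ℕ} (h : r ≤ s) {g : FInf} (hg : g ∈ wordBall r) :
    g ∈ wordBall s :=
  ⟨hg.1.trans h, fun c hc => (hg.2 c hc).trans_le h⟩

theorem exists_mem_wordBall (g : FInf) : ∃ r, g ∈ wordBall r := by
  obtain ⟨b, hb⟩ := (g.toWord.toFinset.image Prod.fst).bddAbove
  refine ⟨max g.toWord.length (b + 1), le_max_left _ _, fun c hc => ?_⟩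
  have : c.1 ≤ b := hb (Finset.mem_image.2 ⟨c, by simpa using hc, rfl⟩)
  exact lt_max_of_lt_right (by omega)

theorem eventually_mem_coords (p : Coord) : ∀ᶠ r in atTop, p ∈ coords r := by
  obtain ⟨r, hr⟩ := exists_mem_wordBall p.1
  obtain ⟨g, _ | i⟩ := p
  · filter_upwards [eventually_ge_atTop r] with s hs
    exact Or.inr (Or.inl ⟨(g, 1), ⟨mem_wordBall_of_le hs hr, one_mem_wordBall s⟩, by simp⟩)
  · filter_upwards [eventually_ge_atTop r, eventually_gt_atTop i] with s hs hi
    exact Or.inl ⟨(g, i), ⟨mem_wordBall_of_le hs hr, hi⟩, rfl⟩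

theorem Nbhd.Iso.trans {r : ℕ} {α β γ : Nbhd r} : α.Iso β → β.Iso γ → α.Iso γ := by
  rintro ⟨e, h₁, h₂, h₃⟩ ⟨f, h₁', h₂', h₃'⟩
  exact ⟨e.trans f, by simp [h₁, h₁'], fun c u v => by simp [h₂, h₂'], fun u => by simp [h₃, h₃']⟩

section Iso

variable {Z Z' : Type} {θ : Action Z} {lab : Z → Cantor} {θ' : Action Z'} {lab' : Z' → Cantor}
  {r : ℕ} {z : Z} {z' : Z'}

/-- An isomorphism of neighbourhoods is forced to be equivariant, as it follows the coloured
edges along paths from the root. -/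
theorem iso_apply_word (e : (nbhd θ lab r z).V ≃ (nbhd θ' lab' r z').V)
    (h₁ : e (nbhd θ lab r z).root = (nbhd θ' lab' r z').root)
    (h₂ : ∀ c u v, (nbhd θ lab r z).edge c u v ↔ (nbhd θ' lab' r z').edge c (e u) (e v))
    (l : List (ℕ × Bool)) (hl : l.length ≤ r) (hc : ∀ c ∈ l, c.1 < r) :
    (e ⟨θ (FreeGroup.mk l) z, _, mk_mem_wordBall hl hc, rfl⟩).1 = θ' (FreeGroup.mk l) z' := by
  induction l with
  | nil =>
    have : (⟨θ (FreeGroup.mk []) z, _, mk_mem_wordBall hl hc, rfl⟩ :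
        (nbhd θ lab r z).V) = (nbhd θ lab r z).root := by
      apply Subtype.ext
      simp [nbhd, ← FreeGroup.one_eq_mk]
    rw [this, h₁]
    simp [nbhd, ← FreeGroup.one_eq_mk]
  | cons c l ih =>
    have hl' : l.length ≤ r := by simp at hl; omega
    have hc' : ∀ c ∈ l, c.1 < r := fun d hd => hc d (List.mem_cons_of_mem _ hd)
    have hmk : (FreeGroup.mk (c :: l) : FInf) =
        (Color.elt ((⟨c.1, hc c List.mem_cons_self⟩, c.2) : Color r)) * FreeGroup.mk l := by
      rw [Color.elt, FreeGroup.mul_mk]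
      rfl
    have := (h₂ (⟨c.1, hc c List.mem_cons_self⟩, c.2)
      ⟨θ (FreeGroup.mk l) z, _, mk_mem_wordBall hl' hc', rfl⟩
      ⟨θ (FreeGroup.mk (c :: l)) z, _, mk_mem_wordBall hl hc, rfl⟩).1 (by
        change θ _ (θ _ z) = θ _ z
        rw [hmk, map_mul, Equiv.Perm.mul_apply])
    change θ' _ (e _).1 = (e _).1 at this
    rw [← this, ih hl' hc', hmk, map_mul, Equiv.Perm.mul_apply]

/-- The isomorphism type of a neighbourhood and the restriction of the code to finitely many
coordinates determine each other. -/
theorem nbhd_iso_iff : (nbhd θ lab r z).Iso (nbhd θ' lab' r z') ↔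
    ∀ p ∈ coords r, code θ lab z p = code θ' lab' z' p := by
  constructor
  · rintro ⟨e, h₁, h₂, h₃⟩
    have he : ∀ g (hg : g ∈ wordBall r), (e ⟨θ g z, g, hg, rfl⟩).1 = θ' g z' := fun g hg => by
      have := iso_apply_word e h₁ h₂ g.toWord hg.1 hg.2
      simpa [FreeGroup.mk_toWord] using this
    rintro p (⟨⟨g, i⟩, ⟨hg, hi⟩, rfl⟩ | ⟨⟨g, h⟩, ⟨hg, hh⟩, rfl⟩ |
      ⟨⟨⟨c, g⟩, h⟩, ⟨⟨-, hg⟩, hh⟩, rfl⟩)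
    · have := congrFun (h₃ ⟨θ g z, g, hg, rfl⟩) ⟨i, hi⟩
      change lab (θ g z) i = lab' (e _).1 i at this
      rw [he g hg] at this
      exact this
    · dsimp only at hg hh ⊢
      rw [code_none_eq_iff, ← he g hg, ← he h hh]
      exact ⟨fun H => congrArg (fun v => (e v).1) (Subtype.ext H),
        fun H => congrArg Subtype.val (e.injective (Subtype.ext H))⟩
    · dsimp only at hg hh ⊢
      rw [code_none_eq_iff, map_mul, map_mul, Equiv.Perm.mul_apply, Equiv.Perm.mul_apply,
        ← he g hg, ← he h hh]
      exact h₂ c ⟨θ g z, g, hg, rfl⟩ ⟨θ h z, h, hh, rfl⟩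
  · intro H
    have heq : ∀ g ∈ wordBall r, ∀ h ∈ wordBall r, (θ g z = θ h z ↔ θ' g z' = θ' h z') :=
      fun g hg h hh => (code_none_eq_iff θ lab θ' lab' z z' g h).1
        (H _ (Or.inr (Or.inl ⟨(g, h), ⟨hg, hh⟩, rfl⟩)))
    let f : (nbhd θ lab r z).V → (nbhd θ' lab' r z').V := fun y =>
      ⟨θ' y.2.choose z', _, y.2.choose_spec.1, rfl⟩
    have hf : ∀ g (hg : g ∈ wordBall r), (f ⟨θ g z, g, hg, rfl⟩).1 = θ' g z' := fun g hg => by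
      let y : (nbhd θ lab r z).V := ⟨θ g z, g, hg, rfl⟩
      exact (heq _ y.2.choose_spec.1 g hg).1 y.2.choose_spec.2
    have hfb : Function.Bijective f := by
      constructor
      · rintro ⟨_, g, hg, rfl⟩ ⟨_, h, hh, rfl⟩ hgh
        have := congrArg Subtype.val hgh
        rw [hf _ hg, hf _ hh] at this
        exact Subtype.ext ((heq g hg h hh).2 this)
      · rintro ⟨_, g, hg, rfl⟩
        exact ⟨⟨θ g z, g, hg, rfl⟩, Subtype.ext (hf g hg)⟩
    refine ⟨Equiv.ofBijective f hfb, ?_, ?_, ?_⟩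
    · apply Subtype.ext
      have := hf 1 (one_mem_wordBall r)
      simp only [map_one, Equiv.Perm.one_apply] at this
      exact this
    · rintro c ⟨_, g, hg, rfl⟩ ⟨_, h, hh, rfl⟩
      change θ c.elt (θ g z) = θ h z ↔ θ' c.elt (f _).1 = (f _).1
      rw [hf _ hg, hf _ hh, ← Equiv.Perm.mul_apply, ← Equiv.Perm.mul_apply, ← map_mul, ← map_mul]
      exact (code_none_eq_iff θ lab θ' lab' z z' _ h).1
        (H _ (Or.inr (Or.inr ⟨((c, g), h), ⟨⟨trivial, hg⟩, hh⟩, rfl⟩)))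
    · rintro ⟨_, g, hg, rfl⟩
      funext i
      change lab (θ g z) i = lab' (f _).1 i
      rw [hf _ hg]
      exact H (g, some i) (Or.inl ⟨(g, i), ⟨hg, i.2⟩, rfl⟩)

end Iso

/-! ### Locally constant functions on products of two-point spaces -/

theorem eventually_forall_mem_eq {ι : Type*} {s : Set ι} (hs : s.Finite) (x : ι → Bool) :
    ∀ᶠ y in 𝓝 x, ∀ i ∈ s, y i = x i := by
  rw [hs.eventually_all]
  intro i _
  exact (continuous_apply i).continuousAt.eventually_mem
    ((isOpen_discrete ({x i} : Set Bool)).mem_nhds rfl)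

theorem isLocallyConstant_of_finite {ι D : Type*} {f : (ι → Bool) → D} {s : Set ι}
    (hs : s.Finite) (hf : DependsOn f s) : IsLocallyConstant f := by
  rw [IsLocallyConstant.iff_eventually_eq]
  intro x
  filter_upwards [eventually_forall_mem_eq hs x] with y hy
  exact hf hy

theorem exists_finite_dependsOn {ι D : Type*} {f : (ι → Bool) → D} (hf : IsLocallyConstant f) :
    ∃ s : Set ι, s.Finite ∧ DependsOn f s := by
  classical
  have h : ∀ x, ∃ s : Set ι, s.Finite ∧ ∀ y, (∀ i ∈ s, y i = x i) → f y = f x := by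
    intro x
    obtain ⟨U, hU, hx, hc⟩ := hf.exists_open x
    obtain ⟨I, u, hu, hsub⟩ := isOpen_pi_iff.1 hU x hx
    refine ⟨I, I.finite_toSet, fun y hy => hc y (hsub fun i hi => ?_)⟩
    rw [hy i hi]
    exact (hu i hi).2
  choose s hs hsx using h
  obtain ⟨t, -, ht⟩ := isCompact_univ.elim_nhds_subcover
    (fun x : ι → Bool => {y | ∀ i ∈ s x, y i = x i}) fun x _ => eventually_forall_mem_eq (hs x) x
  refine ⟨⋃ x ∈ t, s x, t.finite_toSet.biUnion fun x _ => hs x, fun y z hyz => ?_⟩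
  obtain ⟨x, hxt, hx⟩ := Set.mem_iUnion₂.1 (ht (Set.mem_univ y))
  rw [hsx x y hx, hsx x z]
  intro i hi
  rw [← hyz i (Set.mem_biUnion hxt hi)]
  exact hx i hi

theorem isLocallyConstant_mem_iff {X : Type*} [TopologicalSpace X] {C : Set X} :
    IsLocallyConstant (· ∈ C) ↔ IsClopen C := by
  constructor
  · intro h
    simpa using h.isClopen_fiber True
  · intro h
    rw [IsLocallyConstant.iff_eventually_eq]
    intro x
    by_cases hx : x ∈ C
    · filter_upwards [h.isOpen.mem_nhds hx] with y hy
      simp [hx, hy]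
    · filter_upwards [h.compl.isOpen.mem_nhds hx] with y hy
      simp only [Set.mem_compl_iff] at hy
      simp [hx, hy]

/-- The codes that agree with `d` on the coordinates in `s`. -/
def cylinder (s : Set Coord) (d : Code) : Set Code := {k | ∀ p ∈ s, k p = d p}

theorem isClopen_cylinder {s : Set Coord} (hs : s.Finite) (d : Code) :
    IsClopen (cylinder s d) := by
  refine isLocallyConstant_mem_iff.1 (isLocallyConstant_of_finite hs fun k k' h => ?_)
  refine propext (forall₂_congr fun p hp => ?_)
  rw [h p hp]

/-! ### The laws of codes -/

instance (F : FiniteAction) : MeasurableSpace F.Y := ⊤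

instance (F : FiniteAction) : DiscreteMeasurableSpace F.Y := ⟨fun _ => trivial⟩

instance (F : FiniteAction) : Finite F.Y := F.finite

instance (F : FiniteAction) : Nonempty F.Y := F.nonempty

/-- The uniform probability measure of a finite action. -/
noncomputable def FiniteAction.unif (F : FiniteAction) : Measure F.Y :=
  ProbabilityTheory.uniformOn Set.univ

instance (F : FiniteAction) : IsProbabilityMeasure F.unif :=
  ProbabilityTheory.instIsProbabilityMeasure_uniformOn_univ

instance : IsProbabilityMeasure cantorMeasure := by
  unfold cantorMeasure
  infer_instance

theorem FiniteAction.unif_real (F : FiniteAction) (s : Set F.Y) :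
    F.unif.real s = (s.ncard : ℝ) / (Nat.card F.Y : ℝ) := by
  have := Fintype.ofFinite F.Y
  rw [measureReal_def, FiniteAction.unif, ProbabilityTheory.uniformOn_univ,
    Measure.count_apply_finite s s.toFinite, ENNReal.toReal_div, Nat.card_eq_fintype_card,
    Set.ncard_eq_toFinset_card s s.toFinite]
  simp

theorem FiniteAction.unif_real_preimage (F : FiniteAction) (π : Equiv.Perm F.Y) (s : Set F.Y) :
    F.unif.real (π ⁻¹' s) = F.unif.real s := by
  rw [F.unif_real, F.unif_real, ← Set.ncard_image_of_injective (π ⁻¹' s) π.injective,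
    Set.image_preimage_eq _ π.surjective]

/-- The law of the code of a random point of a finite action. -/
noncomputable def FiniteAction.law (F : FiniteAction) : Measure Code :=
  F.unif.map (code F.act F.label)

/-- The law of the code of a random point of an action on the Cantor space. -/
noncomputable def cantorLaw (θ : Action Cantor) : Measure Code :=
  cantorMeasure.map (code θ id)

theorem IsBorelAction.measurable_code {θ : Action Cantor} (hθ : IsBorelAction θ) :
    Measurable (code θ id) := by
  refine measurable_pi_lambda _ ?_
  rintro ⟨g, _ | i⟩
  · refine measurable_to_bool ?_
    have : (fun x => code θ id x (g, none)) ⁻¹' {true} = {x | θ g x = x} := by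
      ext x
      simp
    rw [this]
    exact measurableSet_eq_fun (hθ g) measurable_id
  · exact (measurable_pi_apply i).comp (hθ g)

theorem FiniteAction.measurable_code (F : FiniteAction) : Measurable (code F.act F.label) :=
  measurable_from_top

instance (F : FiniteAction) : IsProbabilityMeasure F.law :=
  Measure.isProbabilityMeasure_map F.measurable_code.aemeasurable

theorem IsBorelAction.isProbabilityMeasure_cantorLaw {θ : Action Cantor} (hθ : IsBorelAction θ) :
    IsProbabilityMeasure (cantorLaw θ) :=
  Measure.isProbabilityMeasure_map hθ.measurable_code.aemeasurable

theorem FiniteAction.law_real (F : FiniteAction) {C : Set Code} (hC : MeasurableSet C) :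
    F.law.real C = F.unif.real {y | code F.act F.label y ∈ C} :=
  map_measureReal_apply F.measurable_code hC

theorem IsBorelAction.cantorLaw_real {θ : Action Cantor} (hθ : IsBorelAction θ) {C : Set Code}
    (hC : MeasurableSet C) :
    (cantorLaw θ).real C = cantorMeasure.real {x | code θ id x ∈ C} :=
  map_measureReal_apply hθ.measurable_code hC

/-- An isomorphism type of neighbourhoods is a clopen set of codes. -/
theorem Nbhd.exists_isClopen {r : ℕ} (α : Nbhd r) : ∃ C : Set Code, IsClopen C ∧
    ∀ (Z : Type) (θ : Action Z) (lab : Z → Cantor),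
      typeSet θ lab α = {z | code θ lab z ∈ C} := by
  refine ⟨{k | ∃ (Z : Type) (θ : Action Z) (lab : Z → Cantor) (z : Z),
    (nbhd θ lab r z).Iso α ∧ code θ lab z ∈ cylinder (coords r) k}, ?_, ?_⟩
  · refine isLocallyConstant_mem_iff.1
      (isLocallyConstant_of_finite (finite_coords r) fun k k' h => propext ?_)
    have : cylinder (coords r) k = cylinder (coords r) k' := by
      ext l
      refine forall₂_congr fun p hp => ?_
      rw [h p hp]
    simp only [Set.mem_ofPred_eq, this]
  · intro Z θ lab
    ext z
    constructor
    · exact fun hz => ⟨Z, θ, lab, z, hz, fun p _ => rfl⟩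
    · rintro ⟨Z', θ', lab', z', hz', hk⟩
      exact (nbhd_iso_iff.2 fun p hp => (hk p hp).symm).trans hz'

/-- Conversely a cylinder over the coordinates of the `r`-neighbourhood is an isomorphism type,
unless no code lies in it. -/
theorem cylinder_coords_eq_typeSet (r : ℕ) (d : Code) :
    (∃ α : Nbhd r, ∀ (Z : Type) (θ : Action Z) (lab : Z → Cantor),
      {z | code θ lab z ∈ cylinder (coords r) d} = typeSet θ lab α) ∨
    ∀ (Z : Type) (θ : Action Z) (lab : Z → Cantor),
      {z | code θ lab z ∈ cylinder (coords r) d} = ∅ := by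
  by_cases h : ∃ (Z : Type) (θ : Action Z) (lab : Z → Cantor) (z : Z),
      code θ lab z ∈ cylinder (coords r) d
  · obtain ⟨Z, θ, lab, z, hz⟩ := h
    refine Or.inl ⟨nbhd θ lab r z, fun Z' θ' lab' => ?_⟩
    ext z'
    refine Iff.trans ?_ nbhd_iso_iff.symm
    exact forall₂_congr fun p hp => by rw [hz p hp]
  · push Not at h
    exact Or.inr fun Z θ lab => Set.eq_empty_of_forall_notMem (h Z θ lab)

theorem FiniteAction.prob_eq (F : FiniteAction) {r : ℕ} (α : Nbhd r) :
    F.prob α = F.unif.real (typeSet F.act F.label α) :=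
  (F.unif_real _).symm

theorem measurableSet_of_isClopen {C : Set Code} (hC : IsClopen C) : MeasurableSet C :=
  hC.isClosed.measurableSet

/-- A clopen set of codes is a finite disjoint union of cylinders. -/
theorem exists_finite_cylinders {C : Set Code} (hC : IsClopen C) :
    ∃ r, 1 ≤ r ∧ ∃ D : Finset Code, (D : Set Code).PairwiseDisjoint (cylinder (coords r)) ∧
      C = ⋃ d ∈ D, cylinder (coords r) d := by
  classical
  obtain ⟨s, hs, hdep⟩ := exists_finite_dependsOn (isLocallyConstant_mem_iff.2 hC)
  obtain ⟨r, hr, hr1⟩ := (((hs.eventually_all).2 fun p _ => eventually_mem_coords p).and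
    (eventually_ge_atTop 1)).exists
  -- a code with all digits outside `coords r` erased represents its cylinder
  let e : Code → Code := fun k p => if p ∈ coords r then k p else false
  have he : ∀ k, ∀ p ∈ coords r, e k p = k p := fun k p hp => if_pos hp
  have hfin : (Set.range e).Finite := by
    have := (finite_coords r).to_subtype
    refine (Set.finite_range fun (f : coords r → Bool) (p : Coord) =>
      if h : p ∈ coords r then f ⟨p, h⟩ else false).subset ?_
    rintro _ ⟨k, rfl⟩
    refine ⟨fun p => k p, ?_⟩
    funext p
    by_cases hp : p ∈ coords r <;> simp [e, hp]
  have hC' : (e '' C).Finite := hfin.subset (Set.image_subset_range _ _)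
  refine ⟨r, hr1, hC'.toFinset, ?_, ?_⟩
  · intro a ha b hb hab
    simp only [Set.Finite.coe_toFinset] at ha hb
    obtain ⟨a, -, rfl⟩ := ha
    obtain ⟨b, -, rfl⟩ := hb
    refine Set.disjoint_left.2 fun k hka hkb => hab ?_
    funext p
    by_cases hp : p ∈ coords r
    · rw [← hka p hp, ← hkb p hp]
    · simp [e, hp]
  · ext k
    simp only [Set.Finite.mem_toFinset, Set.mem_image, Set.iUnion_exists, Set.biUnion_and',
      Set.iUnion_iUnion_eq_right, Set.mem_iUnion, exists_prop]
    constructor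
    · exact fun hk => ⟨k, hk, fun p hp => (he k p hp).symm⟩
    · rintro ⟨k', hk', h⟩
      have : (k ∈ C) = (k' ∈ C) := hdep fun p hp => by rw [h p (hr p hp), he k' p (hr p hp)]
      rwa [this]

/-- Convergence of the local statistics is convergence of the laws of the codes on clopen sets. -/
theorem tendsto_prob_iff {θ : Action Cantor} (hθ : IsBorelAction θ) (F : ℕ → FiniteAction) :
    (∀ r : ℕ, 1 ≤ r → ∀ α : Nbhd r,
      Tendsto (fun n => (F n).prob α) atTop (𝓝 (cantorProb θ α))) ↔
    ∀ C : Set Code, IsClopen C →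
      Tendsto (fun n => (F n).law.real C) atTop (𝓝 ((cantorLaw θ).real C)) := by
  constructor
  · intro H C hC
    obtain ⟨r, hr, D, hD, rfl⟩ := exists_finite_cylinders hC
    have hm : ∀ d ∈ D, MeasurableSet (cylinder (coords r) d) := fun d _ =>
      measurableSet_of_isClopen (isClopen_cylinder (finite_coords r) d)
    have := hθ.isProbabilityMeasure_cantorLaw
    have hsum : ∀ ν : Measure Code, IsProbabilityMeasure ν →
        ν.real (⋃ d ∈ D, cylinder (coords r) d) = ∑ d ∈ D, ν.real (cylinder (coords r) d) :=
      fun ν _ => measureReal_biUnion_finset hD hm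
    simp only [hsum _ this, fun n => hsum (F n).law inferInstance]
    refine tendsto_finsetSum _ fun d hd => ?_
    simp only [FiniteAction.law_real _ (hm d hd), hθ.cantorLaw_real (hm d hd)]
    obtain ⟨α, hα⟩ | h := cylinder_coords_eq_typeSet r d
    · simp only [hα, ← FiniteAction.prob_eq]
      exact H r hr α
    · simp [h]
  · intro H r _ α
    obtain ⟨C, hC, hα⟩ := α.exists_isClopen
    have hm := measurableSet_of_isClopen hC
    have := H C hC
    simp only [FiniteAction.law_real _ hm, hθ.cantorLaw_real hm] at this
    simpa only [FiniteAction.prob_eq, cantorProb, hα] using this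

/-- Soficity without sequences: the law of the codes can be approximated on any finitely many
clopen sets. -/
theorem isSofic_iff {θ : Action Cantor} (hθ : IsBorelAction θ) :
    IsSofic θ ↔ ∀ (T : Finset (TopologicalSpace.Clopens Code)) (ε : ℝ), 0 < ε →
      ∃ F : FiniteAction, ∀ C ∈ T, |F.law.real C - (cantorLaw θ).real C| < ε := by
  classical
  constructor
  · rintro ⟨F, hF⟩ T ε hε
    rw [tendsto_prob_iff hθ] at hF
    have : ∀ᶠ n in atTop, ∀ C ∈ T, |(F n).law.real C - (cantorLaw θ).real C| < ε := by
      rw [Filter.eventually_all_finset]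
      intro C _
      exact (Metric.tendsto_nhds.1 (hF C C.isClopen) ε hε)
    obtain ⟨n, hn⟩ := this.exists
    exact ⟨F n, hn⟩
  · intro H
    have : Countable (TopologicalSpace.Clopens Code) :=
      TopologicalSpace.Clopens.countable_iff_secondCountable.2 inferInstance
    obtain ⟨e, he⟩ := exists_surjective_nat (TopologicalSpace.Clopens Code)
    choose F hF using fun n : ℕ => H ((Finset.range (n + 1)).image e) (1 / ((n : ℝ) + 1))
      Nat.one_div_pos_of_nat
    refine ⟨F, (tendsto_prob_iff hθ F).2 fun C hC => ?_⟩
    obtain ⟨m, hm⟩ := he ⟨C, hC⟩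
    rw [tendsto_iff_norm_sub_tendsto_zero]
    refine squeeze_zero' (Eventually.of_forall fun _ => norm_nonneg _) ?_
      tendsto_one_div_add_atTop_nhds_zero_nat
    filter_upwards [eventually_ge_atTop m] with n hn
    have := hF n ⟨C, hC⟩ (Finset.mem_image.2 ⟨m, by simp; omega, hm⟩)
    exact this.le

/-! ### Approximation of measurable functions by locally constant ones -/

theorem exists_isClopen_measure_le {A : Set Cantor} (hA : MeasurableSet A) {ε : ENNReal}
    (hε : ε ≠ 0) : ∃ C : Set Cantor, IsClopen C ∧ cantorMeasure {x | ¬(x ∈ C ↔ x ∈ A)} ≤ ε := by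
  have hε2 : ε / 2 ≠ 0 := by simpa using hε
  obtain ⟨U, hAU, hU, -, hUA⟩ := hA.exists_isOpen_sdiff_lt (measure_ne_top cantorMeasure A) hε2
  obtain ⟨K, hKA, hK, hAK⟩ := hA.exists_isClosed_sdiff_lt (measure_ne_top cantorMeasure A) hε2
  obtain ⟨C, hC, hKC, hCU⟩ := exists_clopen_of_closed_subset_open hK hU (hKA.trans hAU)
  refine ⟨C, hC, ?_⟩
  calc cantorMeasure {x | ¬(x ∈ C ↔ x ∈ A)} ≤ cantorMeasure ((U \ A) ∪ (A \ K)) := by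
        refine measure_mono fun x hx => ?_
        by_cases hxA : x ∈ A
        · exact Or.inr ⟨hxA, fun hxK => hx ⟨fun _ => hxA, fun _ => hKC hxK⟩⟩
        · refine Or.inl ⟨by_contra fun hxU => hx ?_, hxA⟩
          exact ⟨fun hxC => absurd (hCU hxC) hxU, fun h => absurd h hxA⟩
    _ ≤ ε / 2 + ε / 2 := (measure_union_le _ _).trans (add_le_add hUA.le hAK.le)
    _ = ε := ENNReal.add_halves ε

theorem exists_isClopen_ae_eventually {A : Set Cantor} (hA : MeasurableSet A) :
    ∃ C : ℕ → Set Cantor, (∀ m, IsClopen (C m)) ∧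
      ∀ᵐ x ∂cantorMeasure, ∀ᶠ m in atTop, (x ∈ C m ↔ x ∈ A) := by
  obtain ⟨ε, hε, hsum⟩ := ENNReal.exists_pos_sum_of_countable (ε := 1) one_ne_zero ℕ
  choose C hC hCA using fun m : ℕ => exists_isClopen_measure_le hA
    (ε := ε m) (by simpa using (hε m).ne')
  refine ⟨C, hC, ?_⟩
  have := ae_eventually_notMem (μ := cantorMeasure) (s := fun m => {x | ¬(x ∈ C m ↔ x ∈ A)})
    (ne_top_of_le_ne_top (hsum.trans ENNReal.one_lt_top).ne (ENNReal.tsum_le_tsum hCA))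
  filter_upwards [this] with x hx
  filter_upwards [hx] with m hm
  simpa using hm

/-- A Borel function to a countable set is, almost everywhere, the eventual value of a sequence of
locally constant functions. -/
theorem exists_isLocallyConstant_ae_eventually {D : Type*} [Countable D] [Nonempty D]
    {f : Cantor → D} (hf : ∀ d, MeasurableSet (f ⁻¹' {d})) :
    ∃ f' : ℕ → Cantor → D, (∀ m, IsLocallyConstant (f' m)) ∧
      ∀ᵐ x ∂cantorMeasure, ∀ᶠ m in atTop, f' m x = f x := by
  obtain ⟨e, he⟩ := exists_surjective_nat D
  choose C hC hCe using fun n => exists_isClopen_ae_eventually (hf (e n))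
  -- the first `n < m` for which the clopen approximation of the fibre over `e n` contains `x`
  refine ⟨fun m x => e (sInf {n | x ∈ C n m ∨ m ≤ n}), fun m => ?_, ?_⟩
  · rw [IsLocallyConstant.iff_eventually_eq]
    intro x
    have : ∀ᶠ y in 𝓝 x, ∀ n ∈ Set.Iio m, (y ∈ C n m) = (x ∈ C n m) := by
      rw [(Set.finite_Iio m).eventually_all]
      exact fun n _ => (isLocallyConstant_mem_iff.2 (hC n m)).eventually_eq x
    filter_upwards [this] with y hy
    congr 2
    ext n
    rcases lt_or_ge n m with hn | hn
    · simp [← hy n hn]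
    · simp [hn]
  · filter_upwards [ae_all_iff.2 hCe] with x hx
    have hex : ∃ n, f x = e n := (he (f x)).imp fun _ => Eq.symm
    classical
    have hmin : ∀ {m}, m < Nat.find hex → ¬f x = e m := Nat.find_min hex
    have hspec := Nat.find_spec hex
    set n₀ := Nat.find hex
    have : ∀ᶠ m in atTop, ∀ n ∈ Set.Iic n₀, (x ∈ C n m ↔ x ∈ f ⁻¹' {e n}) := by
      rw [(Set.finite_Iic n₀).eventually_all]
      exact fun n _ => hx n
    filter_upwards [this, eventually_gt_atTop n₀] with m hm hlt
    rw [hspec]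
    congr 1
    refine le_antisymm (Nat.sInf_le (Or.inl ((hm n₀ (Set.mem_Iic.2 le_rfl)).2 hspec))) ?_
    refine le_csInf ⟨m, Or.inr le_rfl⟩ fun n hn => ?_
    by_contra! hlt'
    rcases hn with hn | hn
    · exact hmin hlt' ((hm n (Set.mem_Iic.2 hlt'.le)).1 hn)
    · omega

/-! ### Sofic actions preserve the measure -/

theorem measure_ext_of_isClopen {μ ν : Measure Cantor} [IsProbabilityMeasure μ]
    [IsProbabilityMeasure ν] (h : ∀ A : Set Cantor, IsClopen A → μ A = ν A) : μ = ν := by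
  refine ext_of_generate_finite (measurableCylinders fun _ : ℕ => Bool)
    generateFrom_measurableCylinders.symm isPiSystem_measurableCylinders (fun A hA => ?_) (by simp)
  obtain ⟨s, S, -, rfl⟩ := (mem_measurableCylinders A).1 hA
  exact h _ ((isClopen_discrete S).preimage (Finset.continuous_restrict s))

/-- The label that a code assigns to the point moved by `g`. -/
def labelAt (k : Code) (g : FInf) : Cantor := fun i => k (g, some i)

@[simp] theorem labelAt_code {Z : Type} (θ : Action Z) (lab : Z → Cantor) (z : Z) (g : FInf) :
    labelAt (code θ lab z) g = lab (θ g z) := rfl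

theorem continuous_labelAt (g : FInf) : Continuous fun k => labelAt k g :=
  continuous_pi fun _ => continuous_apply _

/-- In a finite action the label of a random point and that of its translate are equidistributed;
this passes to the limit. -/
theorem IsSofic.measurePreserving {θ : Action Cantor} (hθ : IsBorelAction θ) (h : IsSofic θ)
    (g : FInf) : MeasurePreserving (θ g) cantorMeasure cantorMeasure := by
  refine ⟨hθ g, ?_⟩
  have := Measure.isProbabilityMeasure_map (μ := cantorMeasure) (hθ g).aemeasurable
  refine measure_ext_of_isClopen fun A hA => ?_
  rw [Measure.map_apply (hθ g) hA.isClosed.measurableSet]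
  obtain ⟨F, hF⟩ := h
  rw [tendsto_prob_iff hθ] at hF
  have hcl : ∀ g, IsClopen {k | labelAt k g ∈ A} := fun g => hA.preimage (continuous_labelAt g)
  have h1 := hF _ (hcl g)
  have h2 := hF _ (hcl 1)
  have h12 : ∀ n, (F n).law.real {k | labelAt k g ∈ A} =
      (F n).law.real {k | labelAt k 1 ∈ A} := fun n => by
    rw [FiniteAction.law_real _ (measurableSet_of_isClopen (hcl _)),
      FiniteAction.law_real _ (measurableSet_of_isClopen (hcl _))]
    simp only [Set.mem_ofPred_eq, labelAt_code, map_one, Equiv.Perm.one_apply]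
    exact (F n).unif_real_preimage ((F n).act g) {y | (F n).label y ∈ A}
  simp only [h12] at h1
  have := tendsto_nhds_unique h1 h2
  rw [hθ.cantorLaw_real (measurableSet_of_isClopen (hcl _)),
    hθ.cantorLaw_real (measurableSet_of_isClopen (hcl _))] at this
  simp only [Set.mem_ofPred_eq, labelAt_code, map_one, Equiv.Perm.one_apply, id] at this
  exact (measureReal_eq_measureReal_iff).1 this

/-! ### Walks steered by labels -/

/-- One step of a walk: the rule `f c` reads the label of the point and names the group element
that moves it. -/
def step {Z : Type} (θ : Action Z) (lab : Z → Cantor) (f : ℕ × Bool → Cantor → FInf)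
    (c : ℕ × Bool) (z : Z) : Z :=
  θ (f c (lab z)) z

/-- The walk that takes the steps named by the letters of a word, the last letter first. -/
def walk {Z : Type} (θ : Action Z) (lab : Z → Cantor) (f : ℕ × Bool → Cantor → FInf)
    (l : List (ℕ × Bool)) (z : Z) : Z :=
  l.foldr (step θ lab f) z

/-- The group element that carries the starting point of a walk to its end, as a function of the
code of the starting point. -/
def walkElt (f : ℕ × Bool → Cantor → FInf) : List (ℕ × Bool) → Code → FInf
  | [], _ => 1
  | c :: l, k => f c (labelAt k (walkElt f l k)) * walkElt f l k

theorem walk_eq {Z : Type} (θ : Action Z) (lab : Z → Cantor) (f : ℕ × Bool → Cantor → FInf)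
    (l : List (ℕ × Bool)) (z : Z) :
    walk θ lab f l z = θ (walkElt f l (code θ lab z)) z := by
  induction l with
  | nil => simp [walk, walkElt]
  | cons c l ih =>
    change step θ lab f c (walk θ lab f l z) = _
    rw [ih, walkElt, map_mul, Equiv.Perm.mul_apply, labelAt_code, step]

theorem isLocallyConstant_apply₂ {X A D : Type*} [TopologicalSpace X] {h : X → A} {F : A → X → D}
    (hh : IsLocallyConstant h) (hF : ∀ a, IsLocallyConstant (F a)) :
    IsLocallyConstant fun x => F (h x) x := by
  rw [IsLocallyConstant.iff_eventually_eq]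
  intro x
  filter_upwards [hh.eventually_eq x, (hF (h x)).eventually_eq x] with y h1 h2
  rw [h1, h2]

theorem isLocallyConstant_walkElt {f : ℕ × Bool → Cantor → FInf}
    (hf : ∀ c, IsLocallyConstant (f c)) (l : List (ℕ × Bool)) :
    IsLocallyConstant (walkElt f l) := by
  induction l with
  | nil => exact IsLocallyConstant.const 1
  | cons c l ih =>
    exact isLocallyConstant_apply₂ (F := fun g k => f c (labelAt k g) * g) ih fun g =>
      ((hf c).comp_continuous (continuous_labelAt g)).comp (· * g)

/-- The code that a point would have if the letters acted by the steps of the rules `f`, and if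
labels were replaced by their images under `β`. -/
def recode (f : ℕ × Bool → Cantor → FInf) (β : Cantor → Cantor) (k : Code) : Code := fun p =>
  p.2.elim (k (walkElt f p.1.toWord k, none)) (β (labelAt k (walkElt f p.1.toWord k)))

theorem recode_code_none {Z : Type} (θ : Action Z) (lab : Z → Cantor)
    (f : ℕ × Bool → Cantor → FInf) (β : Cantor → Cantor) (z : Z) (g : FInf) :
    recode f β (code θ lab z) (g, none) = true ↔ walk θ lab f g.toWord z = z := by
  rw [walk_eq, ← code_none θ lab]
  rfl

theorem recode_code_some {Z : Type} (θ : Action Z) (lab : Z → Cantor)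
    (f : ℕ × Bool → Cantor → FInf) (β : Cantor → Cantor) (z : Z) (g : FInf) (i : ℕ) :
    recode f β (code θ lab z) (g, some i) = β (lab (walk θ lab f g.toWord z)) i := by
  rw [walk_eq]
  rfl

theorem continuous_recode {f : ℕ × Bool → Cantor → FInf} (hf : ∀ c, IsLocallyConstant (f c))
    {β : Cantor → Cantor} (hβ : ∀ i, IsLocallyConstant fun x => β x i) :
    Continuous (recode f β) := by
  refine continuous_pi ?_
  rintro ⟨g, _ | i⟩
  · exact (isLocallyConstant_apply₂ (F := fun g k => k (g, none))
      (isLocallyConstant_walkElt hf _) fun _ =>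
        (IsLocallyConstant.iff_continuous _).2 (continuous_apply _)).continuous
  · exact (isLocallyConstant_apply₂ (F := fun g k => β (labelAt k g) i)
      (isLocallyConstant_walkElt hf _) fun g =>
        (hβ i).comp_continuous (continuous_labelAt g)).continuous

/-- The codes of the points at which the rule for the inverse of the `i`-th generator undoes the
rule for that generator. -/
def undone (f : ℕ × Bool → Cantor → FInf) (i : ℕ) : Set Code :=
  {k | k (walkElt f [(i, false), (i, true)] k, none) = true}

theorem code_mem_undone {Z : Type} {θ : Action Z} {lab : Z → Cantor}
    {f : ℕ × Bool → Cantor → FInf} {i : ℕ} {z : Z} :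
    code θ lab z ∈ undone f i ↔ step θ lab f (i, false) (step θ lab f (i, true) z) = z := by
  change _ ↔ walk θ lab f [(i, false), (i, true)] z = z
  rw [walk_eq, ← code_none θ lab]
  rfl

theorem isClopen_undone {f : ℕ × Bool → Cantor → FInf} (hf : ∀ c, IsLocallyConstant (f c))
    (i : ℕ) : IsClopen (undone f i) :=
  (isLocallyConstant_apply₂ (F := fun g (k : Code) => k (g, none))
    (isLocallyConstant_walkElt hf [(i, false), (i, true)]) fun _ =>
      (IsLocallyConstant.iff_continuous _).2 (continuous_apply _)).isClopen_fiber true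

/-! ### Turning the steps of a finite action into permutations -/

theorem exists_perm_eq_of_injOn {Y : Type*} [Finite Y] {f : Y → Y} {s : Set Y}
    (hf : Set.InjOn f s) : ∃ π : Equiv.Perm Y, ∀ y ∈ s, π y = f y := by
  classical
  have := Fintype.ofFinite Y
  obtain ⟨π, hπ⟩ := Set.MapsTo.exists_equiv_extend_of_card_eq (t := (Finset.univ : Finset Y))
    (α := Y) (β := Y) (s := s) (f := f) (by simp)
    (fun y _ => by simp) hf
  exact ⟨π.trans (Equiv.subtypeUnivEquiv (fun _ => Finset.mem_univ _)), fun y hy => hπ y hy⟩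

/-- In a finite action the steps of a generator are almost given by a permutation, the exceptions
being the points where the step of the inverse generator fails to lead back. -/
theorem FiniteAction.exists_recoded (F : FiniteAction) {f : ℕ × Bool → Cantor → FInf}
    (hf : ∀ c, IsLocallyConstant (f c)) {β : Cantor → Cantor}
    (hβ : ∀ i, IsLocallyConstant fun x => β x i) :
    ∃ F' : FiniteAction, ∀ (C : Set Code) (s : Finset Coord),
      IsClopen C → DependsOn (· ∈ C) (s : Set Coord) →
      |F'.law.real C - F.law.real (recode f β ⁻¹' C)| ≤
        ∑ p ∈ s, (p.1.toWord.map fun c => F.law.real (undone f c.1)ᶜ).sum := by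
  have hπ : ∀ i : ℕ, ∃ π : Equiv.Perm F.Y, ∀ y ∈ {y | code F.act F.label y ∈ undone f i},
      π y = step F.act F.label f (i, true) y := fun i => by
    refine exists_perm_eq_of_injOn fun y hy y' hy' h => ?_
    rw [← code_mem_undone.1 hy, ← code_mem_undone.1 hy', h]
  choose π hπ using hπ
  refine ⟨⟨F.Y, F.finite, F.nonempty, FreeGroup.lift π, β ∘ F.label⟩, fun C s hC hs => ?_⟩
  have hm := measurableSet_of_isClopen (hC.preimage (continuous_recode hf hβ))
  have hu := fun i => measurableSet_of_isClopen (isClopen_undone hf i)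
  set act' : Action F.Y := FreeGroup.lift π
  -- where the inverse permutation differs from the step of the inverse letter, the point it leads
  -- to is exceptional
  have hletter : ∀ c y, act' (FreeGroup.mk [c]) y ≠ step F.act F.label f c y →
      (if c.2 then y else (π c.1)⁻¹ y) ∈ {y | code F.act F.label y ∈ (undone f c.1)ᶜ} := by
    rintro ⟨i, _ | _⟩ y h hy
    · refine h ?_
      have h1 := code_mem_undone.1 hy
      rw [← hπ i _ hy] at h1
      simpa [act'] using h1.symm
    · exact h (by simpa [act'] using hπ i y hy)
  have hstep : ∀ c, F.unif.real {y | act' (FreeGroup.mk [c]) y ≠ step F.act F.label f c y} ≤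
      F.law.real (undone f c.1)ᶜ := fun c => by
    rw [F.law_real (hu c.1).compl]
    refine (measureReal_mono (hletter c)).trans ?_
    obtain ⟨i, _ | _⟩ := c
    · exact (F.unif_real_preimage (π i)⁻¹ {y | code F.act F.label y ∈ (undone f i)ᶜ}).le
    · exact le_rfl
  have hword : ∀ l : List (ℕ × Bool),
      F.unif.real {y | act' (FreeGroup.mk l) y ≠ walk F.act F.label f l y} ≤
        (l.map fun c => F.law.real (undone f c.1)ᶜ).sum := by
    intro l
    induction l with
    | nil =>
      simp [walk, ← FreeGroup.one_eq_mk]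
    | cons c l ih =>
      have hsub : {y | act' (FreeGroup.mk (c :: l)) y ≠ walk F.act F.label f (c :: l) y} ⊆
          {y | act' (FreeGroup.mk l) y ≠ walk F.act F.label f l y} ∪ act' (FreeGroup.mk l) ⁻¹'
            {y | act' (FreeGroup.mk [c]) y ≠ step F.act F.label f c y} := by
        intro y hy
        by_contra h
        simp only [Set.mem_union, Set.mem_ofPred_eq, Set.mem_preimage, not_or, not_not] at h
        refine hy ?_
        change _ = step F.act F.label f c (walk F.act F.label f l y)
        rw [← h.1, ← h.2, ← Equiv.Perm.mul_apply, ← map_mul, FreeGroup.mul_mk]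
        rfl
      rw [List.map_cons, List.sum_cons, add_comm]
      refine (measureReal_mono hsub).trans ((measureReal_union_le _ _).trans (add_le_add ih ?_))
      rw [F.unif_real_preimage]
      exact hstep c
  rw [FiniteAction.law_real _ (measurableSet_of_isClopen hC), F.law_real hm]
  change |F.unif.real {y | code act' (β ∘ F.label) y ∈ C} - _| ≤ _
  refine (abs_measureReal_sub_le_measureReal_symmDiff
    (Set.toFinite _).measurableSet.nullMeasurableSet
    (Set.toFinite _).measurableSet.nullMeasurableSet).trans ?_
  have hsub : symmDiff {y | code act' (β ∘ F.label) y ∈ C}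
      {y | code F.act F.label y ∈ recode f β ⁻¹' C} ⊆
      ⋃ p ∈ s, {y | act' (FreeGroup.mk p.1.toWord) y ≠ walk F.act F.label f p.1.toWord y} := by
    intro y hy
    by_contra h
    simp only [Set.mem_iUnion, Set.mem_ofPred_eq, exists_prop, not_exists, not_and, not_not,
      FreeGroup.mk_toWord] at h
    have : (code act' (β ∘ F.label) y ∈ C) = (recode f β (code F.act F.label y) ∈ C) := by
      refine hs ?_
      rintro ⟨g, _ | i⟩ hp
      · rw [Bool.eq_iff_iff, code_none, recode_code_none, h _ hp]
      · rw [code_some, recode_code_some, h _ hp]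
        rfl
    have h' : code act' (β ∘ F.label) y ∈ C ↔ recode f β (code F.act F.label y) ∈ C := this.to_iff
    rcases hy with ⟨h1, h2⟩ | ⟨h1, h2⟩
    · exact h2 (h'.1 h1)
    · exact h2 (h'.2 h1)
  refine (measureReal_mono hsub (measure_ne_top _ _)).trans
    ((measureReal_biUnion_finset_le _ _).trans ?_)
  exact Finset.sum_le_sum fun p _ => hword _

/-! ### Transfer along an orbit equivalence -/

theorem exists_measurable_selection {D : Type*} [Countable D] [Nonempty D]
    {p : Cantor → D → Prop} (hp : ∀ d, MeasurableSet {x | p x d}) :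
    ∃ f : Cantor → D, (∀ d, MeasurableSet (f ⁻¹' {d})) ∧ ∀ x, (∃ d, p x d) → p x (f x) := by
  classical
  obtain ⟨e, he⟩ := exists_surjective_nat D
  -- where there is nothing to select, every index is admitted
  have hex : ∀ x, ∃ n, p x (e n) ∨ ∀ d, ¬p x d := fun x => by
    by_cases h : ∃ d, p x d
    · obtain ⟨d, hd⟩ := h
      obtain ⟨n, rfl⟩ := he d
      exact ⟨n, Or.inl hd⟩
    · exact ⟨0, Or.inr (not_exists.1 h)⟩
  have hm : Measurable fun x => Nat.find (hex x) := measurable_find hex fun n => by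
    have : {x | p x (e n) ∨ ∀ d, ¬p x d} = {x | p x (e n)} ∪ ⋂ d, {x | p x d}ᶜ := by
      ext x
      simp
    rw [this]
    exact (hp _).union (MeasurableSet.iInter fun d => (hp d).compl)
  refine ⟨fun x => e (Nat.find (hex x)), fun d => hm (t := {n | e n = d}) trivial,
    fun x hx => ?_⟩
  obtain ⟨d, hd⟩ := hx
  exact (Nat.find_spec (hex x)).resolve_right fun h => h d hd

theorem tendsto_measureReal_of_ae_eventually {A : ℕ → Set Cantor} {B : Set Cantor}
    (hA : ∀ m, MeasurableSet (A m)) (hB : MeasurableSet B)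
    (h : ∀ᵐ x ∂cantorMeasure, ∀ᶠ m in atTop, (x ∈ A m ↔ x ∈ B)) :
    Tendsto (fun m => cantorMeasure.real (A m)) atTop (𝓝 (cantorMeasure.real B)) :=
  (ENNReal.tendsto_toReal (measure_ne_top _ _)).comp
    (tendsto_measure_of_ae_tendsto_indicator_of_isFiniteMeasure atTop hB hA h)

theorem walk_mem_orbit {Z : Type} (θ : Action Z) (lab : Z → Cantor)
    (f : ℕ × Bool → Cantor → FInf) (l : List (ℕ × Bool)) (z : Z) :
    ∃ g, walk θ lab f l z = θ g z :=
  ⟨_, walk_eq θ lab f l z⟩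

/-- If rules converge pointwise along an orbit, so do the walks steered by them. -/
theorem eventually_walk_eq {θ : Action Cantor} {f : ℕ × Bool → Cantor → FInf}
    {f' : ℕ → ℕ × Bool → Cantor → FInf} {x : Cantor}
    (h : ∀ g c, ∀ᶠ m in atTop, f' m c (θ g x) = f c (θ g x)) (l : List (ℕ × Bool)) :
    ∀ᶠ m in atTop, walk θ id (f' m) l x = walk θ id f l x := by
  induction l with
  | nil => exact Eventually.of_forall fun _ => rfl
  | cons c l ih =>
    obtain ⟨g, hg⟩ := walk_mem_orbit θ id f l x
    filter_upwards [ih, h g c] with m h1 h2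
    change step θ id (f' m) c (walk θ id (f' m) l x) = step θ id f c (walk θ id f l x)
    rw [h1, hg, step, step, id, h2]

/-- If rules follow the generators of `θ₂` along a map `φ`, then walks follow words. -/
theorem apply_walk_eq {θ₁ θ₂ : Action Cantor} {φ : Cantor → Cantor}
    {f : ℕ × Bool → Cantor → FInf} {x : Cantor}
    (h : ∀ g c, φ (θ₁ (f c (θ₁ g x)) (θ₁ g x)) = θ₂ (FreeGroup.mk [c]) (φ (θ₁ g x)))
    (l : List (ℕ × Bool)) : φ (walk θ₁ id f l x) = θ₂ (FreeGroup.mk l) (φ x) := by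
  induction l with
  | nil => simp [walk, ← FreeGroup.one_eq_mk]
  | cons c l ih =>
    obtain ⟨g, hg⟩ := walk_mem_orbit θ₁ id f l x
    change φ (θ₁ (f c (walk θ₁ id f l x)) (walk θ₁ id f l x)) = _
    have : (FreeGroup.mk (c :: l) : FInf) = FreeGroup.mk [c] * FreeGroup.mk l := by
      rw [FreeGroup.mul_mk]
      rfl
    rw [hg, h, ← hg, ih, this, map_mul, Equiv.Perm.mul_apply]

/-- Soficity passes along a measured orbit equivalence `φ`. The generators of `θ₂`, read through
`φ`, move a point `x` by elements of `θ₁` that depend measurably on `x`. Locally constant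
approximations of this dependence make sense on the finite models of `θ₁` too, where they become
models of `θ₂`. -/
theorem IsSofic.of_orbitEquivalent {θ₁ θ₂ : Action Cantor} (h₁ : IsBorelAction θ₁)
    (h₂ : IsBorelAction θ₂) (hs : IsSofic θ₁) (he : OrbitEquivalent θ₁ θ₂) : IsSofic θ₂ := by
  classical
  obtain ⟨φ, ψ, hφ, -, hψφ, -, horb⟩ := he
  have hmp := hs.measurePreserving h₁
  have hinj : ∀ᵐ x ∂cantorMeasure, ∀ g, ψ (φ (θ₁ g x)) = θ₁ g x :=
    ae_all_iff.2 fun g => (hmp g).quasiMeasurePreserving.ae hψφ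
  have horb' : ∀ᵐ x ∂cantorMeasure, ∀ g, φ '' orbit θ₁ (θ₁ g x) = orbit θ₂ (φ (θ₁ g x)) :=
    ae_all_iff.2 fun g => (hmp g).quasiMeasurePreserving.ae horb
  -- the letter `c` of `θ₂` moves `φ x` to `φ (θ₁ (f c x) x)`
  have hsel : ∀ c : ℕ × Bool, ∃ f : Cantor → FInf, (∀ g, MeasurableSet (f ⁻¹' {g})) ∧
      ∀ x, (∃ g, φ (θ₁ g x) = θ₂ (FreeGroup.mk [c]) (φ x)) →
        φ (θ₁ (f x) x) = θ₂ (FreeGroup.mk [c]) (φ x) := fun c =>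
    exists_measurable_selection (p := fun x g => φ (θ₁ g x) = θ₂ (FreeGroup.mk [c]) (φ x))
      fun g => measurableSet_eq_fun (hφ.measurable.comp (h₁ g)) ((h₂ _).comp hφ.measurable)
  choose f hfm hf using hsel
  have hfollow : ∀ᵐ x ∂cantorMeasure, ∀ g c,
      φ (θ₁ (f c (θ₁ g x)) (θ₁ g x)) = θ₂ (FreeGroup.mk [c]) (φ (θ₁ g x)) := by
    filter_upwards [horb'] with x hx g c
    obtain ⟨y, ⟨h, rfl⟩, hy⟩ : θ₂ (FreeGroup.mk [c]) (φ (θ₁ g x)) ∈ φ '' orbit θ₁ (θ₁ g x) := by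
      rw [hx g]
      exact ⟨_, rfl⟩
    exact hf c _ ⟨h, hy⟩
  choose f' hf'lc hf' using fun c => exists_isLocallyConstant_ae_eventually (hfm c)
  choose β' hβ'lc hβ' using fun i : ℕ => exists_isLocallyConstant_ae_eventually
    (f := fun x => φ x i) fun b => ((measurable_pi_apply i).comp hφ.measurable)
      (measurableSet_singleton b)
  let F : ℕ → ℕ × Bool → Cantor → FInf := fun m c => f' c m
  let B : ℕ → Cantor → Cantor := fun m x i => β' i m x
  have hF : ∀ m c, IsLocallyConstant (F m c) := fun m c => hf'lc c m
  have hB : ∀ m i, IsLocallyConstant fun x => B m x i := fun m i => hβ'lc i m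
  have hFlim : ∀ᵐ x ∂cantorMeasure, ∀ g c, ∀ᶠ m in atTop, F m c (θ₁ g x) = f c (θ₁ g x) :=
    ae_all_iff.2 fun g => (hmp g).quasiMeasurePreserving.ae (ae_all_iff.2 hf')
  have hBlim : ∀ᵐ x ∂cantorMeasure, ∀ g i, ∀ᶠ m in atTop, B m (θ₁ g x) i = φ (θ₁ g x) i :=
    ae_all_iff.2 fun g => (hmp g).quasiMeasurePreserving.ae (ae_all_iff.2 hβ')
  -- as `φ` is injective on orbits, it preserves stabilizers
  have hfix : ∀ᵐ x ∂cantorMeasure, ∀ l,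
      (walk θ₁ id f l x = x ↔ θ₂ (FreeGroup.mk l) (φ x) = φ x) := by
    filter_upwards [hfollow, hinj] with x hx hix l
    rw [← apply_walk_eq hx l]
    refine ⟨congrArg φ, fun h => ?_⟩
    obtain ⟨g, hg⟩ := walk_mem_orbit θ₁ id f l x
    have h1 := hix 1
    rw [map_one, Equiv.Perm.one_apply] at h1
    rw [hg] at h ⊢
    rw [← hix g, h, h1]
  -- the codes computed from the approximate rules converge to the codes for `θ₂`
  have hcode : ∀ᵐ x ∂cantorMeasure, ∀ p, ∀ᶠ m in atTop,
      recode (F m) (B m) (code θ₁ id x) p = code θ₂ id (φ x) p := by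
    filter_upwards [hfollow, hfix, hFlim, hBlim] with x hx hfx hFx hBx
    rintro ⟨w, _ | i⟩
    · filter_upwards [eventually_walk_eq hFx w.toWord] with m hm
      rw [Bool.eq_iff_iff, recode_code_none, hm, hfx, FreeGroup.mk_toWord, code_none]
    · obtain ⟨g, hg⟩ := walk_mem_orbit θ₁ id f w.toWord x
      filter_upwards [eventually_walk_eq hFx w.toWord, hBx g i] with m hm hm'
      rw [recode_code_some, hm, id, hg, hm', ← hg, apply_walk_eq hx, FreeGroup.mk_toWord]
      rfl
  have hundone : ∀ᵐ x ∂cantorMeasure, ∀ i, ∀ᶠ m in atTop, code θ₁ id x ∈ undone (F m) i := by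
    filter_upwards [hfix, hFlim] with x hfx hFx i
    filter_upwards [eventually_walk_eq hFx [(i, false), (i, true)]] with m hm
    rw [code_mem_undone]
    change walk θ₁ id (F m) [(i, false), (i, true)] x = x
    have : (FreeGroup.mk [(i, false), (i, true)] : FInf) = 1 := by
      rw [← inv_mul_cancel (FreeGroup.of i)]
      rfl
    rw [hm, hfx, this, map_one, Equiv.Perm.one_apply]
  have hclop : ∀ m C, IsClopen C → MeasurableSet (recode (F m) (B m) ⁻¹' C) := fun m C hC =>
    measurableSet_of_isClopen (hC.preimage (continuous_recode (hF m) (hB m)))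
  have hlaw : ∀ C : Set Code, IsClopen C →
      Tendsto (fun m => (cantorLaw θ₁).real (recode (F m) (B m) ⁻¹' C)) atTop
        (𝓝 ((cantorLaw θ₂).real C)) := fun C hC => by
    have hCm := measurableSet_of_isClopen hC
    obtain ⟨s, hsf, hdep⟩ := exists_finite_dependsOn (isLocallyConstant_mem_iff.2 hC)
    have hCm₂ : MeasurableSet {x | code θ₂ id x ∈ C} := h₂.measurable_code hCm
    rw [h₂.cantorLaw_real hCm, ← hφ.measureReal_preimage hCm₂.nullMeasurableSet]
    simp only [fun m => h₁.cantorLaw_real (hclop m C hC)]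
    refine tendsto_measureReal_of_ae_eventually (fun m => h₁.measurable_code (hclop m C hC))
      (hφ.measurable hCm₂) ?_
    filter_upwards [hcode] with x hx
    filter_upwards [hsf.eventually_all.2 fun p _ => hx p] with m hm
    exact (hdep hm).to_iff
  have hbad : ∀ i, Tendsto (fun m => (cantorLaw θ₁).real (undone (F m) i)ᶜ) atTop (𝓝 0) :=
    fun i => by
    have hm : ∀ m, MeasurableSet (undone (F m) i)ᶜ := fun m =>
      (measurableSet_of_isClopen (isClopen_undone (hF m) i)).compl
    simp only [fun m => h₁.cantorLaw_real (hm m)]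
    rw [← measureReal_empty (μ := cantorMeasure)]
    refine tendsto_measureReal_of_ae_eventually (fun m => h₁.measurable_code (hm m))
      MeasurableSet.empty ?_
    filter_upwards [hundone] with x hx
    filter_upwards [hx i] with m hm
    simpa using hm
  -- fix the accuracy `m` of the rules first, then a model of `θ₁` fine enough for that `m`
  refine (isSofic_iff h₂).2 fun T ε hε => ?_
  choose s hsf hdep using fun C : TopologicalSpace.Clopens Code =>
    exists_finite_dependsOn (isLocallyConstant_mem_iff.2 C.isClopen)
  let err : Measure Code → ℕ → TopologicalSpace.Clopens Code → ℝ := fun ν m C =>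
    ∑ p ∈ (hsf C).toFinset, (p.1.toWord.map fun c => ν.real (undone (F m) c.1)ᶜ).sum
  have herr : ∀ C, Tendsto (fun m => err (cantorLaw θ₁) m C) atTop (𝓝 0) := fun C => by
    have := tendsto_finsetSum (hsf C).toFinset fun p _ =>
      tendsto_list_sum p.1.toWord fun c _ => hbad c.1
    simpa using this
  obtain ⟨m, hm⟩ : ∃ m, ∀ C ∈ T,
      |(cantorLaw θ₁).real (recode (F m) (B m) ⁻¹' C) - (cantorLaw θ₂).real C| < ε / 3 ∧
        err (cantorLaw θ₁) m C < ε / 3 := by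
    refine Eventually.exists (f := atTop) ((Filter.eventually_all_finset T).2 fun C _ => ?_)
    exact (Metric.tendsto_nhds.1 (hlaw C C.isClopen) (ε / 3) (by positivity)).and
      ((herr C).eventually_lt_const (by positivity))
  obtain ⟨Φ, hΦ⟩ := hs
  rw [tendsto_prob_iff h₁] at hΦ
  obtain ⟨n, hn⟩ : ∃ n, ∀ C ∈ T, |(Φ n).law.real (recode (F m) (B m) ⁻¹' C) -
      (cantorLaw θ₁).real (recode (F m) (B m) ⁻¹' C)| < ε / 3 ∧ err (Φ n).law m C < ε / 3 := by
    refine Eventually.exists (f := atTop) ((Filter.eventually_all_finset T).2 fun C hC => ?_)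
    have hlim : Tendsto (fun n => err (Φ n).law m C) atTop (𝓝 (err (cantorLaw θ₁) m C)) :=
      tendsto_finsetSum (hsf C).toFinset fun p _ =>
        tendsto_list_sum p.1.toWord fun c _ => hΦ _ (isClopen_undone (hF m) c.1).compl
    exact (Metric.tendsto_nhds.1
      (hΦ _ (C.isClopen.preimage (continuous_recode (hF m) (hB m)))) (ε / 3) (by positivity)).and
        (hlim.eventually_lt_const (hm C hC).2)
  obtain ⟨F', hF'⟩ := (Φ n).exists_recoded (hF m) (hB m)
  refine ⟨F', fun C hC => ?_⟩
  have h3 : |F'.law.real C - (Φ n).law.real (recode (F m) (B m) ⁻¹' C)| ≤ err (Φ n).law m C :=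
    hF' C (hsf C).toFinset C.isClopen (by simpa using hdep C)
  have h4 := hm C hC
  have h5 := hn C hC
  rw [abs_lt] at h4 h5 ⊢
  rw [abs_le] at h3
  constructor <;> linarith [h4.1.1, h4.1.2, h5.1.1, h5.1.2, h4.2, h5.2, h3.1, h3.2]

theorem OrbitEquivalent.of_defines {θ₁ θ₂ : Action Cantor} {E : Setoid Cantor}
    (h₁ : Defines θ₁ E) (h₂ : Defines θ₂ E) : OrbitEquivalent θ₁ θ₂ :=
  ⟨id, id, MeasurePreserving.id _, MeasurePreserving.id _, ae_of_all _ fun _ => rfl,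
    ae_of_all _ fun _ => rfl, ae_of_all _ fun x => by
      ext y
      rw [Set.image_id, id, ← h₁, ← h₂]⟩

end SoficRel

theorem theorem2p1 :
    (∀ θ₁ θ₂ : SoficRel.Action SoficRel.Cantor,
      SoficRel.IsBorelAction θ₁ → SoficRel.IsBorelAction θ₂ →
      SoficRel.IsSofic θ₁ → SoficRel.OrbitEquivalent θ₁ θ₂ → SoficRel.IsSofic θ₂) ∧
    (∀ E : Setoid SoficRel.Cantor, SoficRel.IsSoficRelation E →
      ∀ θ : SoficRel.Action SoficRel.Cantor,
        SoficRel.IsBorelAction θ → SoficRel.Defines θ E → SoficRel.IsSofic θ) := by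
  refine ⟨fun θ₁ θ₂ h₁ h₂ hs he => hs.of_orbitEquivalent h₁ h₂ he, ?_⟩
  rintro E ⟨θ₀, h₀, hE, hs⟩ θ hθ hd
  exact hs.of_orbitEquivalent h₀ hθ (SoficRel.OrbitEquivalent.of_defines hE hd)
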